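/- Let $\psi:X\times Y\to\mathbb{R}$ be a function (a kernel). Say that $\psi$ has rank $k$ if $k$ is the smallest natural number such that $\operatorname{rank}\big(\{\psi(x_i,y_j)\}_{i,j=1}^m\big)\le k$ for all $m\in\mathbb{N}$, $x_1,\dots,x_m\in X$, $y_1,\dots,y_m\in Y$, and that $\psi$ has finite rank if it has rank $k$ for some $k\in\mathbb{N}$. If $X$ and $Y$ are topological spaces, say that $\psi$ has full rank almost everywhere (a.e.) if for every $k\in\mathbb{N}$ and all nonempty open sets $U_1,\dots,U_k\subset X$ and $V_1,\dots,V_k\subset Y$ there exist $x_i\in U_i$ and $y_j\in V_j$ such that $\operatorname{rank}\big(\{\psi(x_i,y_j)\}_{i,j=1}^k\big)=k$. Let $\mathbb{S}^n\subset\mathbb{R}^{n+1}$ be the unit sphere. (1) For every $n\ge 2$, the geodesic distance $(p,q)\mapsto\arccos(p\cdot q)$ on $\mathbb{S}^n$ and its square $(p,q)\mapsto\arccos^2(p\cdot q)$ have full rank a.e. on $\mathbb{S}^n$. (2) In contrast, for every $n\ge 1$ the squared Euclidean distance $(x,y)\mapsto\|x-y\|^2$ on $\mathbb{R}^n$ has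 finite rank, equal to $n+2$. (3) Also in contrast, on the circle parametrized by the angle in $[0,2\pi]$, the squared distance $(x,y)\mapsto(x-y)^2$, $x,y\in[0,2\pi]$, has finite rank; and neither $\arccos(p\cdot q)$ nor $\arccos^2(p\cdot q)$ has full rank a.e. on $\mathbb{S}^1$. -/

import Mathlib

noncomputable section

namespace KernelRank

/-- The matrix obtained by applying the kernel `ψ` pairwise to two `m`-tuples of points. -/
def sampleMatrix {X Y : Type*} (ψ : X → Y → ℝ) {m : ℕ} (x : Fin m → X) (y : Fin m → Y) :
    Matrix (Fin m) (Fin m) ℝ :=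
  Matrix.of fun i j => ψ (x i) (y j)

/-- `ψ` has rank `k`: `k` is the smallest number that bounds the rank of all sample matrices. -/
def HasRank {X Y : Type*} (ψ : X → Y → ℝ) (k : ℕ) : Prop :=
  IsLeast {r : ℕ | ∀ (m : ℕ) (x : Fin m → X) (y : Fin m → Y), (sampleMatrix ψ x y).rank ≤ r} k

/-- `ψ` has finite rank: it has rank `k` for some natural number `k`. -/
def HasFiniteRank {X Y : Type*} (ψ : X → Y → ℝ) : Prop :=
  ∃ k : ℕ, HasRank ψ k

/-- `ψ` has full rank almost everywhere: for every `k` and all nonempty open sets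
`U₁, …, U_k` and `V₁, …, V_k` one finds `x_i ∈ U_i` and `y_j ∈ V_j` such that the sample
matrix has rank `k`. -/
def FullRankAE {X Y : Type*} [TopologicalSpace X] [TopologicalSpace Y] (ψ : X → Y → ℝ) : Prop :=
  ∀ (k : ℕ) (U : Fin k → Set X) (V : Fin k → Set Y),
    (∀ i, IsOpen (U i) ∧ (U i).Nonempty) → (∀ j, IsOpen (V j) ∧ (V j).Nonempty) →
    ∃ (x : Fin k → X) (y : Fin k → Y),
      (∀ i, x i ∈ U i) ∧ (∀ j, y j ∈ V j) ∧ (sampleMatrix ψ x y).rank = k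

/-- The unit sphere of dimension `n`, as a subspace of the Euclidean space of dimension `n + 1`. -/
abbrev Sphere (n : ℕ) : Type :=
  Metric.sphere (0 : EuclideanSpace ℝ (Fin (n + 1))) 1

/-- The geodesic distance on the unit sphere. -/
def sphereDist (n : ℕ) (p q : Sphere n) : ℝ :=
  Real.arccos (inner ℝ (p : EuclideanSpace ℝ (Fin (n + 1))) (q : EuclideanSpace ℝ (Fin (n + 1))))

/-- The squared Euclidean distance on the Euclidean space of dimension `n`. -/
def euclideanSqDist (n : ℕ) (x y : EuclideanSpace ℝ (Fin n)) : ℝ :=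
  ‖x - y‖ ^ 2

/-- The squared distance of angular parameters of the circle, both in `[0, 2π]`. -/
def circleSqDist (x y : Set.Icc (0 : ℝ) (2 * Real.pi)) : ℝ :=
  ((x : ℝ) - (y : ℝ)) ^ 2

end KernelRank

end

/-! A kernel that is a sum of N products a(x)b(y) has sample matrices factoring through ℝ^N, so its
ranks are at most N. Expanding squares settles the squared distances. On S¹ the distance between two
suitable arcs is a difference of angles, which rules out full rank.

For n ≥ 2, take pairwise non-parallel `x i`. A relation ∑ c_i arccos(x_i·y)^s = 0 on an open set is
restricted to a great circle through `x o` and a generic y. The other terms are analytic and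
2π-periodic along the whole circle, while the term of `o` is locally c_o t^s. Analytic continuation
extends the relation to all t, and comparing t = 0 with t = 2π gives c_o = 0. Independence on every
`V j` then lets the sample points be chosen greedily. -/

namespace KernelRank

open Module

/-! ### Sums of separated products -/

/-- A kernel which is a sum of products of functions of one variable has small sample ranks. -/
theorem rank_sampleMatrix_le {X Y ι : Type*} [Fintype ι] {ψ : X → Y → ℝ}
    {a : ι → X → ℝ} {b : ι → Y → ℝ} (h : ∀ x y, ψ x y = ∑ l, a l x * b l y)
    {m : ℕ} (x : Fin m → X) (y : Fin m → Y) :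
    (sampleMatrix ψ x y).rank ≤ Fintype.card ι := by
  have hmul : sampleMatrix ψ x y =
      (Matrix.of fun i l => a l (x i)) * (Matrix.of fun l j => b l (y j)) := by
    ext i j
    simp [sampleMatrix, Matrix.mul_apply, h]
  rw [hmul]
  exact (Matrix.rank_mul_le_left _ _).trans (Matrix.rank_le_card_width _)

theorem hasFiniteRank_of_eq_sum {X Y ι : Type*} [Fintype ι] {ψ : X → Y → ℝ}
    {a : ι → X → ℝ} {b : ι → Y → ℝ} (h : ∀ x y, ψ x y = ∑ l, a l x * b l y) :
    HasFiniteRank ψ := by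
  have hne : {r : ℕ | ∀ (m : ℕ) (x : Fin m → X) (y : Fin m → Y),
      (sampleMatrix ψ x y).rank ≤ r}.Nonempty :=
    ⟨Fintype.card ι, fun _ x y => rank_sampleMatrix_le h x y⟩
  exact ⟨_, Nat.sInf_mem hne, fun _ hr => Nat.sInf_le hr⟩

/-- The hypotheses `hx` and `hy` make both factors of the sample matrix invertible, so the bound by
the number of terms is attained. -/
theorem card_le_of_eq_sum {X Y ι : Type*} [Fintype ι] {ψ : X → Y → ℝ}
    {a : ι → X → ℝ} {b : ι → Y → ℝ} (h : ∀ x y, ψ x y = ∑ l, a l x * b l y)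
    (x : ι → X) (y : ι → Y)
    (hx : ∀ c : ι → ℝ, (∀ i, ∑ l, a l (x i) * c l = 0) → c = 0)
    (hy : ∀ c : ι → ℝ, (∀ j, ∑ l, b l (y j) * c l = 0) → c = 0)
    {r : ℕ} (hr : ∀ (m : ℕ) (x : Fin m → X) (y : Fin m → Y), (sampleMatrix ψ x y).rank ≤ r) :
    Fintype.card ι ≤ r := by
  classical
  have key : ∀ M : Matrix ι ι ℝ, (∀ c : ι → ℝ, (∀ i, ∑ l, M i l * c l = 0) → c = 0) →
      IsUnit M := fun M hM => by
    rw [← Matrix.mulVec_injective_iff_isUnit]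
    refine (injective_iff_map_eq_zero M.mulVecLin).2 fun c hc => hM c fun i => ?_
    simpa [Matrix.mulVec, dotProduct] using congrFun hc i
  have hA := key (Matrix.of fun i l => a l (x i)) hx
  have hB := key (Matrix.of fun j l => b l (y j)) hy
  let e := (Fintype.equivFin ι).symm
  have hmul : sampleMatrix ψ (x ∘ e) (y ∘ e) =
      ((Matrix.of fun i l => a l (x i)) * (Matrix.of fun j l => b l (y j)).transpose).submatrix
        e e := by
    ext i j
    simp [sampleMatrix, Matrix.mul_apply, h]
  have hrank := hr _ (x ∘ e) (y ∘ e)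
  rw [hmul, Matrix.rank_submatrix, Matrix.rank_of_isUnit] at hrank
  · exact hrank
  · exact hA.mul ((Matrix.isUnit_transpose _).2 hB)

theorem not_fullRankAE_of_eq_sum_on {X Y ι : Type*} [TopologicalSpace X] [TopologicalSpace Y]
    [Fintype ι] {ψ : X → Y → ℝ} {a : ι → X → ℝ} {b : ι → Y → ℝ} {U : Set X} {V : Set Y}
    (hU : IsOpen U) (hU' : U.Nonempty) (hV : IsOpen V) (hV' : V.Nonempty)
    (h : ∀ x ∈ U, ∀ y ∈ V, ψ x y = ∑ l, a l x * b l y) : ¬ FullRankAE ψ := by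
  intro hfull
  obtain ⟨x, y, hx, hy, hrank⟩ := hfull (Fintype.card ι + 1) (fun _ => U) (fun _ => V)
    (fun _ => ⟨hU, hU'⟩) (fun _ => ⟨hV, hV'⟩)
  have := rank_sampleMatrix_le (ψ := fun (x : U) (y : V) => ψ x y)
    (a := fun l x => a l x) (b := fun l y => b l y) (fun x y => h x x.2 y y.2)
    (fun i => ⟨x i, hx i⟩) (fun j => ⟨y j, hy j⟩)
  have heq : sampleMatrix (fun (x : U) (y : V) => ψ x y)
      (fun i => ⟨x i, hx i⟩) (fun j => ⟨y j, hy j⟩) = sampleMatrix ψ x y := rfl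
  rw [heq] at this
  omega

/-! ### Squared Euclidean distance -/

theorem hasRank_euclideanSqDist {n : ℕ} (hn : 1 ≤ n) : HasRank (euclideanSqDist n) (n + 2) := by
  classical
  let a : Option (Option (Fin n)) → EuclideanSpace ℝ (Fin n) → ℝ := fun l x =>
    l.elim (‖x‖ ^ 2) fun l => l.elim 1 fun i => -2 * x i
  let b : Option (Option (Fin n)) → EuclideanSpace ℝ (Fin n) → ℝ := fun l x =>
    l.elim 1 fun l => l.elim (‖x‖ ^ 2) fun i => x i
  have hab : ∀ x y, euclideanSqDist n x y = ∑ l, a l x * b l y := by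
    intro x y
    rw [euclideanSqDist, @norm_sub_sq_real]
    simp only [Fintype.sum_option, a, b, Option.elim, PiLp.inner_apply, RCLike.inner_apply,
      conj_trivial, Finset.mul_sum, sub_eq_add_neg, ← Finset.sum_neg_distrib]
    rw [Finset.sum_congr rfl (g := fun i => -2 * x i * y i) (fun i _ => by ring)]
    ring
  let i₀ : Fin n := ⟨0, hn⟩
  -- The origin and the unit vectors force t = 0 and s + w_i = 0. The extra point 2e₀ gives 4s + 2w₀
  -- = 0, hence s = 0. Both factor families reduce to this test.
  let p : Option (Option (Fin n)) → EuclideanSpace ℝ (Fin n) := fun l =>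
    l.elim 0 fun l => l.elim (EuclideanSpace.single i₀ 2) fun i => EuclideanSpace.single i 1
  have hp : ∀ (s t : ℝ) (w : Fin n → ℝ),
      (∀ l, s * ‖p l‖ ^ 2 + t + ∑ i, p l i * w i = 0) → s = 0 ∧ t = 0 ∧ w = 0 := by
    intro s t w h
    have ht : t = 0 := by simpa [p] using h none
    have h1 : ∀ i, s + w i = 0 := fun i => by
      simpa [p, ht, PiLp.single_apply] using h (some (some i))
    have h2 : s * 2 ^ 2 + 2 * w i₀ = 0 := by
      simpa [p, ht, PiLp.single_apply] using h (some none)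
    have hs : s = 0 := by linarith [h1 i₀]
    exact ⟨hs, ht, funext fun i => by simpa [hs] using h1 i⟩
  have hcard : Fintype.card (Option (Option (Fin n))) = n + 2 := by simp
  refine ⟨fun m x y => hcard ▸ rank_sampleMatrix_le hab x y, fun r hr =>
    hcard ▸ card_le_of_eq_sum hab p p ?_ ?_ hr⟩
  · intro c hc
    obtain ⟨h0, h1, h2⟩ := hp (c none) (c (some none)) (fun i => -2 * c (some (some i)))
      fun l => by
        rw [← hc l]
        simp only [Fintype.sum_option, a, Option.elim]
        rw [Finset.sum_congr rfl (g := fun i => -2 * p l i * c (some (some i)))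
          (fun i _ => by ring)]
        ring
    funext l
    rcases l with _ | _ | i
    · exact h0
    · exact h1
    · simpa using congrFun h2 i
  · intro c hc
    obtain ⟨h0, h1, h2⟩ := hp (c (some none)) (c none) (fun i => c (some (some i)))
      fun l => by
        rw [← hc l]
        simp only [Fintype.sum_option, b, Option.elim]
        ring
    funext l
    rcases l with _ | _ | i
    · exact h1
    · exact h0
    · simpa using congrFun h2 i

theorem hasFiniteRank_circleSqDist : HasFiniteRank circleSqDist :=
  hasFiniteRank_of_eq_sum (ι := Fin 3)
    (a := ![fun x => (x : ℝ) ^ 2, fun x => -2 * (x : ℝ), fun _ => 1])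
    (b := ![fun _ => 1, fun y => (y : ℝ), fun y => (y : ℝ) ^ 2]) fun x y => by
      simp [Fin.sum_univ_three, circleSqDist]
      ring

/-! ### The circle -/

theorem inner_sphere_one (p q : Sphere 1) :
    inner ℝ (p : EuclideanSpace ℝ (Fin 2)) (q : EuclideanSpace ℝ (Fin 2)) =
      p.1 0 * q.1 0 + p.1 1 * q.1 1 := by
  simp [PiLp.inner_apply, Fin.sum_univ_two, mul_comm]

/-- On the right half-circle `arcsin` of the second coordinate is the angle. The sign conditions
keep the angle difference in [0, π], where `arccos` inverts `cos`. -/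
theorem sphereDist_one_eq {p q : Sphere 1} (hp0 : 0 < p.1 0) (hp1 : 0 < p.1 1)
    (hq0 : 0 < q.1 0) (hq1 : q.1 1 < 0) :
    sphereDist 1 p q = Real.arcsin (p.1 1) - Real.arcsin (q.1 1) := by
  have key : ∀ r : Sphere 1, 0 < r.1 0 → r.1 0 ^ 2 + r.1 1 ^ 2 = 1 ∧
      r.1 0 = Real.cos (Real.arcsin (r.1 1)) ∧ r.1 1 = Real.sin (Real.arcsin (r.1 1)) := by
    intro r hr
    have h1 : r.1 0 ^ 2 + r.1 1 ^ 2 = 1 := by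
      have h := inner_sphere_one r r
      rw [real_inner_self_eq_norm_sq, norm_eq_of_mem_sphere] at h
      linarith
    refine ⟨h1, ?_, ?_⟩
    · rw [Real.cos_arcsin, show 1 - r.1 1 ^ 2 = r.1 0 ^ 2 by linarith, Real.sqrt_sq hr.le]
    · rw [Real.sin_arcsin] <;> nlinarith
  obtain ⟨-, hp0', hp1'⟩ := key p hp0
  obtain ⟨-, hq0', hq1'⟩ := key q hq0
  have e1 := Real.arcsin_le_pi_div_two (p.1 1)
  have e2 := Real.neg_pi_div_two_le_arcsin (q.1 1)
  have e3 := Real.arcsin_pos.2 hp1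
  have e4 := Real.arcsin_lt_zero.2 hq1
  have hin : inner ℝ (p : EuclideanSpace ℝ (Fin 2)) (q : EuclideanSpace ℝ (Fin 2)) =
      Real.cos (Real.arcsin (p.1 1) - Real.arcsin (q.1 1)) := by
    rw [inner_sphere_one, Real.cos_sub, ← hp0', ← hp1', ← hq0', ← hq1']
  rw [sphereDist, hin, Real.arccos_cos] <;> linarith

theorem quadrants_sphere_one :
    (IsOpen {p : Sphere 1 | 0 < p.1 0 ∧ 0 < p.1 1} ∧
      {p : Sphere 1 | 0 < p.1 0 ∧ 0 < p.1 1}.Nonempty) ∧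
    (IsOpen {p : Sphere 1 | 0 < p.1 0 ∧ p.1 1 < 0} ∧
      {p : Sphere 1 | 0 < p.1 0 ∧ p.1 1 < 0}.Nonempty) := by
  have hc : ∀ i, Continuous fun p : Sphere 1 => p.1 i := fun i => by fun_prop
  refine ⟨⟨(isOpen_lt continuous_const (hc 0)).inter (isOpen_lt continuous_const (hc 1)),
    ⟨⟨!₂[3 / 5, 4 / 5], ?_⟩, ?_⟩⟩,
    ⟨(isOpen_lt continuous_const (hc 0)).inter (isOpen_lt (hc 1) continuous_const),
    ⟨⟨!₂[3 / 5, -(4 / 5)], ?_⟩, ?_⟩⟩⟩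
  · simp [EuclideanSpace.norm_eq, Fin.sum_univ_two]; norm_num
  · constructor <;> simp
  · simp [EuclideanSpace.norm_eq, Fin.sum_univ_two]; norm_num
  · constructor <;> simp

theorem not_fullRankAE_sphereDist_one :
    ¬ FullRankAE (fun p q : Sphere 1 => sphereDist 1 p q) := by
  obtain ⟨⟨h1, h2⟩, ⟨h3, h4⟩⟩ := quadrants_sphere_one
  refine not_fullRankAE_of_eq_sum_on (ι := Fin 2) h1 h2 h3 h4
    (a := ![fun p => Real.arcsin (p.1 1), fun _ => -1])
    (b := ![fun _ => 1, fun q => Real.arcsin (q.1 1)]) fun p hp q hq => ?_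
  rw [sphereDist_one_eq hp.1 hp.2 hq.1 hq.2]
  simp [Fin.sum_univ_two]
  ring

theorem not_fullRankAE_sphereDist_one_sq :
    ¬ FullRankAE (fun p q : Sphere 1 => sphereDist 1 p q ^ 2) := by
  obtain ⟨⟨h1, h2⟩, ⟨h3, h4⟩⟩ := quadrants_sphere_one
  refine not_fullRankAE_of_eq_sum_on (ι := Fin 3) h1 h2 h3 h4
    (a := ![fun p => Real.arcsin (p.1 1) ^ 2, fun p => -2 * Real.arcsin (p.1 1), fun _ => 1])
    (b := ![fun _ => 1, fun q => Real.arcsin (q.1 1), fun q => Real.arcsin (q.1 1) ^ 2])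
    fun p hp q hq => ?_
  rw [sphereDist_one_eq hp.1 hp.2 hq.1 hq.2]
  simp [Fin.sum_univ_three]
  ring

/-! ### From linear independence to full rank -/

theorem exists_linearIndependent_of_span_eq_top {E : Type*} [AddCommGroup E] [Module ℝ E]
    [FiniteDimensional ℝ E] (m : ℕ) (hm : m ≤ finrank ℝ E) (S : Fin m → Set E)
    (hS : ∀ j, Submodule.span ℝ (S j) = ⊤) :
    ∃ v : Fin m → E, (∀ j, v j ∈ S j) ∧ LinearIndependent ℝ v := by
  induction m with
  | zero => exact ⟨Fin.elim0, fun j => j.elim0, linearIndependent_empty_type⟩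
  | succ m ih =>
    obtain ⟨v, hv, hli⟩ := ih (by omega) (fun j => S j.succ) fun j => hS _
    have hex : ∃ x ∈ S 0, x ∉ Submodule.span ℝ (Set.range v) := by
      by_contra! h
      have htop : Submodule.span ℝ (Set.range v) = ⊤ :=
        top_le_iff.1 (hS 0 ▸ Submodule.span_le.2 h)
      have hcard := finrank_range_le_card (R := ℝ) v
      rw [Set.finrank, htop, finrank_top, Fintype.card_fin] at hcard
      omega
    obtain ⟨x, hx, hxv⟩ := hex
    refine ⟨Fin.cons x v, fun j => ?_, linearIndependent_finCons.2 ⟨hli, hxv⟩⟩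
    refine Fin.cases ?_ (fun j => ?_) j
    · simpa using hx
    · simpa using hv j

/-- Finitely many functions that are linearly independent on each of the sets `V j` give an
invertible sample matrix at suitable points of these sets. -/
theorem exists_rank_sampleMatrix_eq {X Y : Type*} {ψ : X → Y → ℝ} {k : ℕ} (x : Fin k → X)
    (V : Fin k → Set Y)
    (h : ∀ j (c : Fin k → ℝ), (∀ y ∈ V j, ∑ i, c i * ψ (x i) y = 0) → c = 0) :
    ∃ y : Fin k → Y, (∀ j, y j ∈ V j) ∧ (sampleMatrix ψ x y).rank = k := by
  obtain ⟨v, hv, hli⟩ := exists_linearIndependent_of_span_eq_top (E := Fin k → ℝ) k (by simp)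
    (fun j => (fun y i => ψ (x i) y) '' V j) fun j => by
      by_contra hne
      -- A nonzero functional killing all evaluation vectors would be a nontrivial relation between
      -- the functions `ψ (x i)` on `V j`.
      obtain ⟨f, hf, hle⟩ := Submodule.exists_le_ker_of_lt_top _ (lt_top_iff_ne_top.2 hne)
      refine hf (LinearMap.ext fun z => ?_)
      have hz := h j (fun i => f fun l => if i = l then 1 else 0) fun y hy => by
        have := hle (Submodule.subset_span (Set.mem_image_of_mem _ hy))
        rw [LinearMap.mem_ker, LinearMap.pi_apply_eq_sum_univ] at this
        simpa [mul_comm] using this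
      rw [LinearMap.pi_apply_eq_sum_univ]
      exact Finset.sum_eq_zero fun i _ => by rw [congrFun hz i]; simp
  choose y hy hyv using hv
  refine ⟨y, hy, ?_⟩
  have hrow : LinearIndependent ℝ (sampleMatrix ψ x y).transpose.row := by
    have : (sampleMatrix ψ x y).transpose.row = v := funext fun j => hyv j
    rwa [this]
  rw [← Matrix.rank_transpose, hrow.rank_matrix, Fintype.card_fin]

/-! ### Great circles and analytic continuation on the sphere -/

section InnerProduct

variable {E : Type*} [NormedAddCommGroup E] [InnerProductSpace ℝ E]

/-- The open cone over `V` has positive volume, whereas proper subspaces are null sets. -/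
theorem exists_mem_sphere_forall_notMem [FiniteDimensional ℝ E] {ι : Type*} [Finite ι]
    {V : Set (Metric.sphere (0 : E) 1)} (hV : IsOpen V) (hV' : V.Nonempty)
    (p : ι → Submodule ℝ E) (hp : ∀ i, p i ≠ ⊤) :
    ∃ y ∈ V, ∀ i, (y : E) ∉ p i := by
  borelize E
  obtain ⟨W, hW, rfl⟩ := isOpen_induced_iff.1 hV
  obtain ⟨y, hy⟩ := hV'
  have hcont : ContinuousOn (fun z : E => ‖z‖⁻¹ • z) {0}ᶜ := fun z hz =>
    ((continuous_norm.continuousAt.inv₀ (norm_ne_zero_iff.2 hz)).smul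
      continuousAt_id).continuousWithinAt
  have hopen : IsOpen ({0}ᶜ ∩ (fun z : E => ‖z‖⁻¹ • z) ⁻¹' W) :=
    hcont.isOpen_inter_preimage isOpen_compl_singleton hW
  have hy1 : ‖(y : E)‖ = 1 := norm_eq_of_mem_sphere y
  have hne : ({0}ᶜ ∩ (fun z : E => ‖z‖⁻¹ • z) ⁻¹' W).Nonempty :=
    ⟨y, norm_ne_zero_iff.1 (by simp [hy1]), by simpa [hy1] using hy⟩
  have hpos := hopen.measure_pos MeasureTheory.volume hne
  have hnull : MeasureTheory.volume (⋃ i, (p i : Set E)) = 0 :=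
    MeasureTheory.measure_iUnion_null fun i =>
      MeasureTheory.Measure.addHaar_submodule _ _ (hp i)
  obtain ⟨z, ⟨hz0, hzW⟩, hzp⟩ : ∃ z ∈ {0}ᶜ ∩ (fun z : E => ‖z‖⁻¹ • z) ⁻¹' W,
      z ∉ ⋃ i, (p i : Set E) := by
    by_contra! h
    exact hpos.ne' (MeasureTheory.measure_mono_null h hnull)
  have hz : ‖z‖ ≠ 0 := norm_ne_zero_iff.2 hz0
  refine ⟨⟨‖z‖⁻¹ • z, by simp [norm_smul, hz]⟩, hzW, fun i hi => hzp ?_⟩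
  exact Set.mem_iUnion.2 ⟨i, ((p i).smul_mem_iff (inv_ne_zero hz)).1 hi⟩

theorem abs_inner_lt_one_of_notMem_span {x y : E} (hx : ‖x‖ = 1) (hy : ‖y‖ = 1)
    (h : y ∉ Submodule.span ℝ {x}) : |inner ℝ x y| < 1 := by
  refine lt_of_le_of_ne (by simpa [hx, hy] using abs_real_inner_le_norm x y) fun he => h ?_
  obtain ⟨-, r, -, hr⟩ := (abs_real_inner_div_norm_mul_norm_eq_one_iff x y).1 (by simp [hx, hy, he])
  exact Submodule.mem_span_singleton.2 ⟨r, hr.symm⟩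

/-- The great circle through `x` with unit tangent vector `e`. -/
noncomputable def greatCircle (x e : E) (t : ℝ) : E := Real.cos t • x + Real.sin t • e

theorem norm_greatCircle {x e : E} (hx : ‖x‖ = 1) (he : ‖e‖ = 1) (hxe : inner ℝ x e = 0) (t : ℝ) :
    ‖greatCircle x e t‖ = 1 := by
  have h : ‖greatCircle x e t‖ ^ 2 = 1 := by
    rw [greatCircle, norm_add_sq_real, norm_smul, norm_smul, inner_smul_left, inner_smul_right,
      hxe, hx, he]
    simp
  exact (pow_eq_one_iff_of_nonneg (norm_nonneg _) two_ne_zero).1 h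

theorem continuous_greatCircle (x e : E) : Continuous (greatCircle x e) :=
  (Real.continuous_cos.smul continuous_const).add (Real.continuous_sin.smul continuous_const)

theorem exists_greatCircle_eq {x y : E} (hx : ‖x‖ = 1) (hy : ‖y‖ = 1)
    (h : y ∉ Submodule.span ℝ {x}) :
    ∃ e ∈ Submodule.span ℝ {x, y}, ‖e‖ = 1 ∧ inner ℝ x e = 0 ∧
      ∃ t ∈ Set.Ioo 0 Real.pi, greatCircle x e t = y := by
  have hlt := abs_lt.1 (abs_inner_lt_one_of_notMem_span hx hy h)
  set a : ℝ := inner ℝ x y with ha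
  have hpos : 0 < 1 - a ^ 2 := by nlinarith
  have hs : √(1 - a ^ 2) ≠ 0 := (Real.sqrt_pos.2 hpos).ne'
  have hnorm : ‖y - a • x‖ = √(1 - a ^ 2) := by
    rw [eq_comm, Real.sqrt_eq_iff_mul_self_eq hpos.le (norm_nonneg _), ← sq, norm_sub_sq_real,
      inner_smul_right, real_inner_comm, ← ha, norm_smul, hx, hy, Real.norm_eq_abs, mul_one, sq_abs]
    ring
  refine ⟨(√(1 - a ^ 2))⁻¹ • (y - a • x), ?_, ?_, ?_, Real.arccos a, ?_, ?_⟩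
  · refine Submodule.smul_mem _ _ (Submodule.sub_mem _ (Submodule.subset_span (by simp))
      (Submodule.smul_mem _ _ (Submodule.subset_span (by simp))))
  · rw [norm_smul, hnorm, norm_inv, Real.norm_of_nonneg (Real.sqrt_nonneg _), inv_mul_cancel₀ hs]
  · rw [inner_smul_right, inner_sub_right, inner_smul_right, ← ha, real_inner_self_eq_norm_sq, hx]
    simp
  · exact ⟨Real.arccos_pos.2 hlt.2, Real.arccos_lt_pi.2 hlt.1⟩
  · rw [greatCircle, Real.cos_arccos hlt.1.le hlt.2.le, Real.sin_arccos, smul_smul,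
      mul_inv_cancel₀ hs, one_smul]
    abel

theorem analyticAt_arccos {u : ℝ} (h : |u| < 1) : AnalyticAt ℝ Real.arccos u := by
  rw [abs_lt] at h
  exact (Real.contDiffAt_arccos (n := ⊤) h.1.ne' h.2.ne).analyticAt

theorem analyticAt_arccos_inner_greatCircle {x e z : E} {t : ℝ}
    (h : |inner ℝ z (greatCircle x e t)| < 1) :
    AnalyticAt ℝ (fun t => Real.arccos (inner ℝ z (greatCircle x e t))) t := by
  have heq : (fun t => inner ℝ z (greatCircle x e t)) =
      fun t => Real.cos t * inner ℝ z x + Real.sin t * inner ℝ z e := by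
    funext t
    simp [greatCircle, inner_add_right, inner_smul_right]
  refine (analyticAt_arccos h).fun_comp_of_eq ?_ rfl
  rw [heq]
  exact (Real.analyticAt_cos.mul analyticAt_const).add (Real.analyticAt_sin.mul analyticAt_const)

theorem finrank_span_pair_le (x y : E) : finrank ℝ (Submodule.span ℝ {x, y}) ≤ 2 := by
  classical
  have := finrank_span_finset_le_card (R := ℝ) ({x, y} : Finset E)
  rw [Set.finrank, Finset.coe_pair] at this
  exact this.trans Finset.card_le_two

/-- Powers of the distances to pairwise non-parallel points are linearly independent on every
nonempty open subset of the sphere. -/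
theorem coeff_eq_zero_of_sum_arccos_pow_eq_zero [FiniteDimensional ℝ E] (hE : 3 ≤ finrank ℝ E)
    {ι : Type*} [Fintype ι] {x : ι → E} (hx : ∀ i, ‖x i‖ = 1)
    (hpar : ∀ i j, i ≠ j → x j ∉ Submodule.span ℝ {x i}) {V : Set (Metric.sphere (0 : E) 1)}
    (hV : IsOpen V) (hV' : V.Nonempty) {s : ℕ} (hs : s ≠ 0) {c : ι → ℝ}
    (hc : ∀ y ∈ V, ∑ i, c i * Real.arccos (inner ℝ (x i) (y : E)) ^ s = 0) (o : ι) : c o = 0 := by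
  classical
  -- Dimension at least 3 makes these planes proper. The index `o` itself yields the line through `x
  -- o`.
  obtain ⟨y, hyV, hy⟩ := exists_mem_sphere_forall_notMem hV hV'
    (fun i => Submodule.span ℝ {x o, x i}) fun i htop => by
      have := finrank_span_pair_le (x o) (x i)
      rw [htop, finrank_top] at this
      omega
  have hy1 : ‖(y : E)‖ = 1 := norm_eq_of_mem_sphere y
  have hyo : (y : E) ∉ Submodule.span ℝ {x o} := by simpa using hy o
  obtain ⟨e, hemem, he, hxe, t₀, ht₀, hgy⟩ := exists_greatCircle_eq (hx o) hy1 hyo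
  have hmem : ∀ t, greatCircle (x o) e t ∈ Submodule.span ℝ {x o, (y : E)} := fun t =>
    Submodule.add_mem _ (Submodule.smul_mem _ _ (Submodule.subset_span (by simp)))
      (Submodule.smul_mem _ _ hemem)
  have hnorm := norm_greatCircle (hx o) he hxe
  have hnot : ∀ i, i ≠ o → x i ∉ Submodule.span ℝ {x o, (y : E)} := by
    intro i hi hmem
    obtain ⟨a, b, hab⟩ := Submodule.mem_span_pair.1 hmem
    rcases eq_or_ne b 0 with rfl | hb
    · exact hpar o i hi.symm (Submodule.mem_span_singleton.2 ⟨a, by simpa using hab⟩)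
    · refine hy i (Submodule.mem_span_pair.2 ⟨-(b⁻¹ * a), b⁻¹, ?_⟩)
      rw [← hab, smul_add, smul_smul, smul_smul, inv_mul_cancel₀ hb, one_smul, neg_smul]
      abel
  -- The great circle avoids ±`x i`, the only points where `arccos` of the inner product is
  -- singular.
  have hlt : ∀ i, i ≠ o → ∀ t, |inner ℝ (x i) (greatCircle (x o) e t)| < 1 := by
    intro i hi t
    rw [real_inner_comm]
    refine abs_inner_lt_one_of_notMem_span (hnorm t) (hx i) fun h => hnot i hi ?_
    exact (Submodule.span_singleton_le_iff_mem _ _).2 (hmem t) h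
  let g : ℝ → ℝ := fun t => ∑ i ∈ Finset.univ.erase o,
    c i * Real.arccos (inner ℝ (x i) (greatCircle (x o) e t)) ^ s
  have hg : AnalyticOnNhd ℝ (fun t => c o * t ^ s + g t) Set.univ := fun t _ =>
    (analyticAt_const.mul (analyticAt_id.pow s)).add
      (Finset.analyticAt_fun_sum _ fun i hi => analyticAt_const.mul
        ((analyticAt_arccos_inner_greatCircle (hlt i (Finset.ne_of_mem_erase hi) t)).pow s))
  let γ : ℝ → Metric.sphere (0 : E) 1 := fun t => ⟨greatCircle (x o) e t, by simp [hnorm t]⟩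
  have hγ : Continuous γ := (continuous_greatCircle (x o) e).subtype_mk _
  have hγ₀ : γ t₀ = y := Subtype.ext hgy
  have hev : (fun t => c o * t ^ s + g t) =ᶠ[nhds t₀] fun _ => 0 := by
    filter_upwards [hγ.continuousAt.preimage_mem_nhds (hV.mem_nhds (hγ₀.symm ▸ hyV)),
      Ioo_mem_nhds ht₀.1 ht₀.2] with t htV ht
    have hin : inner ℝ (x o) (greatCircle (x o) e t) = Real.cos t := by
      rw [greatCircle, inner_add_right, inner_smul_right, inner_smul_right, hxe,
        real_inner_self_eq_norm_sq, hx]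
      simp
    have h0 := hc _ htV
    rw [← Finset.add_sum_erase _ _ (Finset.mem_univ o)] at h0
    simpa only [γ, hin, Real.arccos_cos ht.1.le ht.2.le] using h0
  have hzero := hg.eq_of_eventuallyEq (fun _ _ => analyticAt_const) hev
  have h0 := congrFun hzero 0
  -- After a full turn `g` returns to its value, but t^s has grown from 0 to (2π)^s.
  have h1 := congrFun hzero (2 * Real.pi)
  have hper : g (2 * Real.pi) = g 0 := by simp [g, greatCircle]
  simp only [hper, zero_pow hs, mul_zero, zero_add] at h0 h1
  rw [h0, add_zero] at h1
  exact (mul_eq_zero.1 h1).resolve_right (pow_ne_zero _ (by positivity))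

theorem exists_pairwise_notMem_span [FiniteDimensional ℝ E] (hE : 2 ≤ finrank ℝ E) (k : ℕ)
    (U : Fin k → Set (Metric.sphere (0 : E) 1)) (hU : ∀ i, IsOpen (U i) ∧ (U i).Nonempty) :
    ∃ x : Fin k → Metric.sphere (0 : E) 1, (∀ i, x i ∈ U i) ∧
      ∀ i j, i ≠ j → (x j : E) ∉ Submodule.span ℝ {(x i : E)} := by
  induction k with
  | zero => exact ⟨Fin.elim0, fun i => i.elim0, fun i => i.elim0⟩
  | succ k ih =>
    obtain ⟨x, hxU, hx⟩ := ih (fun i => U i.succ) fun i => hU _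
    obtain ⟨y, hyU, hy⟩ := exists_mem_sphere_forall_notMem (hU 0).1 (hU 0).2
      (fun i => Submodule.span ℝ {(x i : E)}) fun i htop => by
        have := finrank_span_singleton (K := ℝ) (ne_zero_of_mem_unit_sphere (x i))
        rw [htop, finrank_top] at this
        omega
    refine ⟨Fin.cons y x, Fin.cases hyU hxU, fun i j hij => ?_⟩
    · induction i using Fin.cases <;> induction j using Fin.cases
      · exact absurd rfl hij
      · rename_i j
        simp only [Fin.cons_zero, Fin.cons_succ]
        intro hmem
        obtain ⟨a, ha⟩ := Submodule.mem_span_singleton.1 hmem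
        have ha0 : a ≠ 0 := by
          rintro rfl
          exact ne_zero_of_mem_unit_sphere (x j) (by simpa using ha.symm)
        exact hy j (Submodule.mem_span_singleton.2 ⟨a⁻¹, by rw [← ha, inv_smul_smul₀ ha0]⟩)
      · simpa using hy _
      · simpa using hx _ _ fun h => hij (congrArg Fin.succ h)

end InnerProduct

theorem fullRankAE_sphereDist_pow {n : ℕ} (hn : 2 ≤ n) {s : ℕ} (hs : s ≠ 0) :
    FullRankAE (fun p q : Sphere n => sphereDist n p q ^ s) := by
  intro k U V hU hV
  have hfin : finrank ℝ (EuclideanSpace ℝ (Fin (n + 1))) = n + 1 := by simp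
  obtain ⟨x, hxU, hx⟩ := exists_pairwise_notMem_span (by omega) k U hU
  obtain ⟨y, hyV, hrank⟩ := exists_rank_sampleMatrix_eq
    (ψ := fun p q : Sphere n => sphereDist n p q ^ s) x V fun j c hc => funext fun i =>
      coeff_eq_zero_of_sum_arccos_pow_eq_zero (by omega)
        (fun i => norm_eq_of_mem_sphere (x i)) hx (hV j).1 (hV j).2 hs hc i
  exact ⟨x, y, hxU, hyV, hrank⟩

end KernelRank

theorem proposition4 :
    (∀ n : ℕ, 2 ≤ n →
      KernelRank.FullRankAE (fun p q : KernelRank.Sphere n => KernelRank.sphereDist n p q) ∧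
      KernelRank.FullRankAE (fun p q : KernelRank.Sphere n => KernelRank.sphereDist n p q ^ 2)) ∧
    (∀ n : ℕ, 1 ≤ n → KernelRank.HasRank (KernelRank.euclideanSqDist n) (n + 2)) ∧
    KernelRank.HasFiniteRank KernelRank.circleSqDist ∧
    (¬ KernelRank.FullRankAE (fun p q : KernelRank.Sphere 1 => KernelRank.sphereDist 1 p q) ∧
      ¬ KernelRank.FullRankAE
        (fun p q : KernelRank.Sphere 1 => KernelRank.sphereDist 1 p q ^ 2)) :=
  ⟨fun _ hn => ⟨by simpa using KernelRank.fullRankAE_sphereDist_pow hn one_ne_zero,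
    KernelRank.fullRankAE_sphereDist_pow hn two_ne_zero⟩,
    fun _ => KernelRank.hasRank_euclideanSqDist, KernelRank.hasFiniteRank_circleSqDist,
    KernelRank.not_fullRankAE_sphereDist_one, KernelRank.not_fullRankAE_sphereDist_one_sq⟩
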